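/- All graphs are finite, without loops or multiple edges. A tripartition of a graph $G$ is a partition $(A,B,C)$ of $V(G)$ into three nonempty stable sets. For a vertex $v$, let $N^2_A(v)$ denote the set of vertices in $A$ at distance exactly two from $v$. For $x,y\in(0,1]$, $G$ is $(x,y)$-biconstrained via a tripartition $(A,B,C)$ if there are no edges between $A$ and $C$, every vertex in $A$ has at least $x|B|$ neighbours in $B$, every vertex in $B$ has at least $y|C|$ neighbours in $C$ and at least $x|A|$ neighbours in $A$, and every vertex in $C$ has at least $y|B|$ neighbours in $B$. Let $\psi(x,y)$ be the maximum (equivalently, the supremum) of all $z\in(0,1]$ such that, for every graph $G$ and all $A,B,C$, if $G$ is $(x,y)$-biconstrained via $(A,B,C)$, then $|N^2_A(v)|\ge z|A|$ for some $v\in C$. Theorem. Let $x,y\in(0,1]$ be such that $$x^2(1+3y)+x(4y^2-y-2)+1-2y+2y^3<0.$$ Then $\psi(x,y)\ge 1/2$. -/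

import Mathlib

namespace Tripartite

variable {V : Type*}

/-- A tripartition of `G`: a partition of the vertex set into three nonempty stable sets. -/
structure IsTripartition (G : SimpleGraph V) (A B C : Set V) : Prop where
  nonempty_A : A.Nonempty
  nonempty_B : B.Nonempty
  nonempty_C : C.Nonempty
  disjoint_AB : Disjoint A B
  disjoint_AC : Disjoint A C
  disjoint_BC : Disjoint B C
  union_eq : A ∪ B ∪ C = Set.univ
  indep_A : G.IsIndepSet A
  indep_B : G.IsIndepSet B
  indep_C : G.IsIndepSet C

/-- `G` is `(x, y)`-constrained via the tripartition `(A, B, C)`. -/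
structure IsConstrained (G : SimpleGraph V) (x y : ℝ) (A B C : Set V) : Prop
    extends IsTripartition G A B C where
  deg_AB : ∀ v ∈ A, x * (B.ncard : ℝ) ≤ ((G.neighborSet v ∩ B).ncard : ℝ)
  deg_BC : ∀ v ∈ B, y * (C.ncard : ℝ) ≤ ((G.neighborSet v ∩ C).ncard : ℝ)
  no_edge_AC : ∀ a ∈ A, ∀ c ∈ C, ¬ G.Adj a c

/-- `G` is `(x, y)`-biconstrained via the tripartition `(A, B, C)`. -/
structure IsBiconstrained (G : SimpleGraph V) (x y : ℝ) (A B C : Set V) : Prop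
    extends IsConstrained G x y A B C where
  deg_BA : ∀ v ∈ B, x * (A.ncard : ℝ) ≤ ((G.neighborSet v ∩ A).ncard : ℝ)
  deg_CB : ∀ v ∈ C, y * (B.ncard : ℝ) ≤ ((G.neighborSet v ∩ B).ncard : ℝ)

/-- The set `N²(v)` of vertices at distance exactly two from `v`. -/
def secondNeighborSet (G : SimpleGraph V) (v : V) : Set V :=
  {u | G.dist v u = 2}

/-- The set of all `z ∈ (0, 1]` such that in every finite graph that is `(x, y)`-biconstrained via
some `(A, B, C)`, some `v ∈ C` satisfies `|N²(v) ∩ A| ≥ z |A|`. -/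
def psiSet (x y : ℝ) : Set ℝ :=
  {z | z ∈ Set.Ioc (0 : ℝ) 1 ∧
    ∀ (V : Type) [Finite V] (G : SimpleGraph V) (A B C : Set V),
      IsBiconstrained G x y A B C →
        ∃ v ∈ C, z * (A.ncard : ℝ) ≤ ((secondNeighborSet G v ∩ A).ncard : ℝ)}

/-- The function `ψ`: the largest element of `psiSet x y`. -/
noncomputable def psi (x y : ℝ) : ℝ := sSup (psiSet x y)

end Tripartite

open Finset
set_option linter.unusedSectionVars false

/-! ### Numerical consequences of the polynomial inequality -/

namespace Tripartite
-- Suppose no vertex of C reaches half of A in two steps. Double counting shows that for every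
-- weighting of C some a in A reaches less than half of the weight (`exists_weight_lt_half`). If a
-- misses certain vertices of C, their joint neighbourhood in B avoids that of a, so it has density
-- at most 1 - x. Call two vertices of C linked when they share a neighbour b. Both then reach all
-- neighbours of b in A, so adding a linked vertex enlarges the reached part of A by less than 1/2 -
-- x.
--
-- The polynomial enters only through simpler inequalities, in three ranges of y. For y ≥ 1/3 all
-- pairs are linked, and three greedily chosen vertices cover more than 1 - x of B although a common
-- a misses them (`false_of_pow_lt`). For 1/4 ≤ y < 1/3 a quadratic form is minimised over the
-- distributions on A (`exists_half_le_density`).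
--
-- For y < 1/4 the aim is to cut C into two parts with no links between them, each missed by some a.
-- This is impossible (`false_of_separated`): spread equal weight uniformly over each part; a
-- Cauchy–Schwarz estimate shows that every a reaches at least half of the total. If being linked is
-- not transitive, the vertices linked to a path u, m, v form one part. If it is transitive, there
-- are at most three link classes, and some a reaches only one of them.
theorem one_lt_two_mul_add_of_poly_neg {x y : ℝ} (hy : 0 < y) (hy3 : y < 1 / 3)
    (h : x ^ 2 * (1 + 3 * y) + x * (4 * y ^ 2 - y - 2) + 1 - 2 * y + 2 * y ^ 3 < 0) :
    1 < 2 * x + y := by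
  by_contra hc
  push Not at hc
  -- Four times the value of the polynomial at x = (1 - y) / 2. The product in `h2` is its value at
  -- x minus this value. The next lemmas compare values in the same way.
  have h1 : 0 ≤ (1 - 3 * y) * (1 - 2 * y - y ^ 2) := by
    apply mul_nonneg <;> nlinarith
  have h2 : 0 ≤ ((1 - y) / 2 - x) * ((2 - (4 * y ^ 2 - y)) - (1 + 3 * y) * (x + (1 - y) / 2)) := by
    apply mul_nonneg
    · linarith
    · nlinarith
  nlinarith

theorem one_lt_add_two_mul_of_poly_neg {x y : ℝ} (hy : 0 < y) (hy3 : 1 / 3 ≤ y)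
    (h : x ^ 2 * (1 + 3 * y) + x * (4 * y ^ 2 - y - 2) + 1 - 2 * y + 2 * y ^ 3 < 0) :
    1 < x + 2 * y := by
  by_contra hc
  push Not at hc
  have h1 : 0 ≤ y ^ 2 * (3 * y - 1) := by
    apply mul_nonneg <;> nlinarith
  have h2 : 0 ≤ ((1 - 2 * y) - x) * ((2 - (4 * y ^ 2 - y)) - (1 + 3 * y) * (x + (1 - 2 * y))) := by
    apply mul_nonneg
    · linarith
    · nlinarith
  nlinarith

theorem quarter_lt_of_poly_neg {x y : ℝ} (hy3 : 1 / 3 ≤ y) (hy1 : y ≤ 1) (hx : 0 < x)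
    (h : x ^ 2 * (1 + 3 * y) + x * (4 * y ^ 2 - y - 2) + 1 - 2 * y + 2 * y ^ 3 < 0) :
    1 / 4 < x := by
  by_contra hc
  push Not at hc
  have h0 : y < 1 / 2 := by
    by_contra hh
    push Not at hh
    nlinarith [mul_nonneg (sub_nonneg.2 hh) (sub_nonneg.2 hy1), mul_pos hx hx, sq_nonneg (x * 5 - 1.5), mul_nonneg hx.le (sub_nonneg.2 hh), mul_nonneg (sub_nonneg.2 hh) (sq_nonneg (y-1/2)), mul_nonneg (sub_nonneg.2 hh) (sq_nonneg (x-1/2)), mul_nonneg (sub_nonneg.2 hh) (sq_nonneg x)]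
  -- The polynomial at x = 1/4; its minimum over positive y is near 0.443.
  have h1 : 0 < 0.5625 - 2.0625 * y + y ^ 2 + 2 * y ^ 3 := by
    nlinarith [sq_nonneg (y - 0.443), mul_nonneg (by linarith : (0:ℝ) ≤ y) (sq_nonneg (y - 0.443))]
  have h2 : 0 ≤ (1 / 4 - x) * ((2 - (4 * y ^ 2 - y)) - (1 + 3 * y) * (x + 1 / 4)) := by
    apply mul_nonneg
    · linarith
    · nlinarith
  nlinarith

theorem pow_lt_of_one_lt {x y : ℝ} (hx4 : 1 / 4 < x) (hxy : 1 < x + 2 * y) (hy0 : 0 < y) (hy : y ≤ 1) :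
    (1 - y) ^ 3 < x := by
  rcases le_total y (3 / 8) with h | h
  · have : 0 < y * (1 - 3 * y + y ^ 2) := mul_pos hy0 (by nlinarith)
    nlinarith
  · have : (1 - y) ^ 3 ≤ (5 / 8) ^ 3 := by
      apply pow_le_pow_left₀ <;> linarith
    norm_num at this ⊢
    linarith

/-- Replaces the curved boundary of the region by a line, so that the estimates needed for y < 1/4
become elementary. -/
theorem linear_lt_of_poly_neg {x y : ℝ} (hy0 : 0 < y) (hy : y < 1 / 4) (hx : x < 1 / 2)
    (h : x ^ 2 * (1 + 3 * y) + x * (4 * y ^ 2 - y - 2) + 1 - 2 * y + 2 * y ^ 3 < 0) :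
    0.775 - 1.43 * y < x := by
  by_contra hc
  push Not at hc
  rcases le_total y 0.19 with hy2 | hy2
  -- The polynomial decreases in x up to 1/2 and is nonnegative at x = 1/2 when y ≤ 0.19, so this
  -- range is empty.
  · have h2 : 0 ≤ (1 / 2 - x) * ((2 - (4 * y ^ 2 - y)) - (1 + 3 * y) * (x + 1 / 2)) := by
      apply mul_nonneg
      · linarith
      · nlinarith
    nlinarith [mul_nonneg hy0.le (sub_nonneg.2 hy2), sq_nonneg y, mul_nonneg hy0.le (sq_nonneg y)]
  · set X := 0.775 - 1.43 * y with hX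
    have h2 : 0 ≤ (X - x) * ((2 - (4 * y ^ 2 - y)) - (1 + 3 * y) * (x + X)) := by
      apply mul_nonneg
      · linarith
      · nlinarith
    have h3 : 0 ≤ X ^ 2 * (1 + 3 * y) + X * (4 * y ^ 2 - y - 2) + 1 - 2 * y + 2 * y ^ 3 := by
      rw [hX]
      nlinarith [mul_nonneg hy0.le (sq_nonneg (y - 0.22)), sq_nonneg (y - 0.22)]
    nlinarith

/-- The number 0.2325 + 1.07 y is a linear lower bound for √y on the remaining range, with equality
at y = 1/4. It serves as the parameter `r` of `false_of_separated`. -/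
theorem bounds_of_linear_lt {x y : ℝ} (hy : y < 1 / 4) (hx : x < 1 / 2) (hl : 0.775 - 1.43 * y < x) :
    1 - x < 3 * y ∧ (1 - y) * (1 - 2 * y) < x ∧ 2 * (1 - 2 * x) * (1 - y) < y ∧
    (1 - x - 2 * y) * (1 - (0.2325 + 1.07 * y)) ^ 2 < y * (2 * x + y - 1) ∧
    (0.2325 + 1.07 * y) ^ 2 ≤ y := by
  have hy2 : 0.192 < y := by linarith
  refine ⟨by linarith, ?_, ?_, ?_, ?_⟩
  · nlinarith
  · nlinarith
  · have : 0 < (y - 0.192) := by linarith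
    have h3 : (1 - (0.775 - 1.43 * y) - 2 * y) * (1 - (0.2325 + 1.07 * y)) ^ 2 < y * (2 * (0.775 - 1.43 * y) + y - 1) := by
      nlinarith [mul_pos this (sub_pos.2 hy), mul_pos (mul_pos this (sub_pos.2 hy)) (sub_pos.2 hy)]
    nlinarith [mul_nonneg (sub_nonneg.2 hl.le) (sq_nonneg (1 - (0.2325 + 1.07 * y))), mul_nonneg (sub_nonneg.2 hl.le) (by linarith : 0 ≤ y)]
  · nlinarith

end Tripartite

/-! ### Densities, double counting and two averaging principles -/

namespace Tripartite

section Density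
/-- The proportion of the elements of a finite type that lie in `s`. -/
noncomputable def density {ι : Type*} [Fintype ι] (s : Finset ι) : ℝ :=
  (s.card : ℝ) / Fintype.card ι

variable {ι κ : Type*} [Fintype ι] [Fintype κ]

theorem density_nonneg (s : Finset ι) : 0 ≤ density s := by
  unfold density; positivity

theorem density_mono {s t : Finset ι} (h : s ⊆ t) : density s ≤ density t := by
  unfold density
  gcongr

theorem density_univ [Nonempty ι] : density (univ : Finset ι) = 1 := by
  unfold density
  rw [card_univ, div_self]
  exact_mod_cast Fintype.card_ne_zero

theorem density_pos {s : Finset ι} (h : s.Nonempty) : 0 < density s := by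
  unfold density
  have : 0 < s.card := h.card_pos
  have h2 : 0 < Fintype.card ι := this.trans_le (card_le_univ s)
  positivity

theorem nonempty_of_density_pos {s : Finset ι} (h : 0 < density s) : s.Nonempty := by
  rw [nonempty_iff_ne_empty]
  rintro rfl
  simp [density] at h

/-- Double counting of the pairs of a relation between two sets, in terms of densities. -/
theorem density_double_count [Nonempty ι] [Nonempty κ] (R : ι → κ → Prop)
    [∀ i k, Decidable (R i k)] (D : Finset ι) (X : Finset κ) {p q : ℝ}
    (hp : ∀ k ∈ X, p ≤ density (D.filter fun i => R i k))
    (hq : ∀ i ∈ D, density (X.filter fun k => R i k) ≤ q) :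
    p * density X ≤ q * density D := by
  have hι : (0 : ℝ) < Fintype.card ι := by exact_mod_cast Fintype.card_pos
  have hκ : (0 : ℝ) < Fintype.card κ := by exact_mod_cast Fintype.card_pos
  unfold density at *
  have h := sum_card_bipartiteAbove_eq_sum_card_bipartiteBelow (s := D) (t := X) R
  have h1 : ∑ k ∈ X, p * Fintype.card ι ≤ ∑ k ∈ X, ((D.filter fun i => R i k).card : ℝ) :=
    sum_le_sum fun k hk => (le_div_iff₀ hι).1 (hp k hk)
  have h2 : ∑ i ∈ D, ((X.filter fun k => R i k).card : ℝ) ≤ ∑ i ∈ D, q * Fintype.card κ :=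
    sum_le_sum fun i hi => (div_le_iff₀ hκ).1 (hq i hi)
  have h' : ∑ i ∈ D, ((X.filter fun k => R i k).card : ℝ)
      = ∑ k ∈ X, ((D.filter fun i => R i k).card : ℝ) := by
    exact_mod_cast h
  rw [sum_const, nsmul_eq_mul] at h1 h2
  rw [← mul_div_assoc, ← mul_div_assoc, div_le_div_iff₀ hκ hι]
  nlinarith

variable [DecidableEq ι]

theorem density_union_add_inter (s t : Finset ι) :
    density (s ∪ t) + density (s ∩ t) = density s + density t := by
  unfold density
  rw [← add_div, ← add_div]
  congr 1
  exact_mod_cast card_union_add_card_inter s t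

theorem density_union_of_disjoint {s t : Finset ι} (h : Disjoint s t) :
    density (s ∪ t) = density s + density t := by
  have := density_union_add_inter s t
  rw [disjoint_iff_inter_eq_empty.1 h] at this
  simpa [density] using this

theorem density_union_le (s t : Finset ι) : density (s ∪ t) ≤ density s + density t := by
  have := density_union_add_inter s t
  linarith [density_nonneg (s ∩ t)]

theorem density_sdiff_add_inter (s t : Finset ι) :
    density (s \ t) + density (s ∩ t) = density s := by
  rw [← density_union_of_disjoint (disjoint_sdiff_inter s t), sdiff_union_inter]

theorem density_add_le_one [Nonempty ι] {s t : Finset ι} (h : Disjoint s t) :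
    density s + density t ≤ 1 := by
  rw [← density_union_of_disjoint h, ← density_univ (ι := ι)]
  exact density_mono (subset_univ _)

theorem density_compl [Nonempty ι] (s : Finset ι) : density sᶜ = 1 - density s := by
  have := density_union_of_disjoint (disjoint_compl_right (a := s))
  rw [union_compl, density_univ] at this
  linarith

theorem exists_notMem_of_density_lt_one [Nonempty ι] {s : Finset ι} (h : density s < 1) :
    ∃ i, i ∉ s := by
  by_contra hc
  push Not at hc
  rw [eq_univ_of_forall hc, density_univ] at h
  exact lt_irrefl _ h

end Density

/-- The family `S` of subsets of a finite set, indexed by a finite set, has all of its members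
of density less than one half; then every weighting has an element contained in less than half
of the family. -/
theorem exists_weight_lt_half {α γ ι : Type*} [Fintype α] [Nonempty α] [DecidableEq α]
    [Fintype ι] (S : γ → Finset α) (hS : ∀ c, density (S c) < 1 / 2)
    (f : ι → γ) (w : ι → ℝ) (hw : ∀ i, 0 ≤ w i) (hpos : 0 < ∑ i, w i) :
    ∃ a, (∑ i, if a ∈ S (f i) then w i else 0) < (∑ i, w i) / 2 := by
  by_contra hc
  push Not at hc
  have hα : (0 : ℝ) < Fintype.card α := by exact_mod_cast Fintype.card_pos
  have h1 : ∑ _a : α, (∑ i, w i) / 2 ≤ ∑ a : α, ∑ i, if a ∈ S (f i) then w i else 0 :=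
    sum_le_sum fun a _ => hc a
  rw [sum_comm] at h1
  have h2 : ∀ i, (∑ a : α, if a ∈ S (f i) then w i else 0)
      = w i * (density (S (f i)) * Fintype.card α) := by
    intro i
    rw [← sum_filter, sum_const, nsmul_eq_mul, mul_comm]
    unfold density
    rw [div_mul_cancel₀ _ hα.ne']
    simp
  simp only [h2, sum_const, card_univ, nsmul_eq_mul] at h1
  have h3 : ∑ i, w i * (density (S (f i)) * Fintype.card α)
      < ∑ i, w i * (1 / 2 * Fintype.card α) := by
    obtain ⟨j, -, hj⟩ : ∃ j ∈ univ, 0 < w j := by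
      by_contra hh
      push Not at hh
      exact absurd hpos (not_lt.2 (sum_nonpos hh))
    apply sum_lt_sum
    · intro i _
      have := hS (f i)
      gcongr
      exact hw i
    · refine ⟨j, mem_univ _, ?_⟩
      have := hS (f j)
      gcongr
  rw [← sum_mul] at h3
  nlinarith

/-- A finite family of nonempty sets whose members either cover the ground set in pairs or meet in
a quarter of it admits no distribution under which every point lies in less than half of it. -/
theorem exists_half_le_density {α γ : Type*} [Fintype α] [Nonempty α] [DecidableEq α]
    [Fintype γ] [Nonempty γ] [DecidableEq γ] (L : α → Finset γ) (hne : ∀ a, (L a).Nonempty)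
    (hL : ∀ a a', (∃ c, c ∉ L a ∧ c ∉ L a') → 1 / 4 ≤ density (L a ∩ L a')) :
    ∃ c, 1 / 2 ≤ density (univ.filter fun a => c ∈ L a) := by
  by_contra hcon
  push Not at hcon
  have hα : (0 : ℝ) < Fintype.card α := by exact_mod_cast Fintype.card_pos
  have hγ : (0 : ℝ) < Fintype.card γ := by exact_mod_cast Fintype.card_pos
  -- `z p c` is the probability that c lies in `L a` for a random a with distribution p. The proof
  -- minimises the sum `Q` of its squares.
  let z : (α → ℝ) → γ → ℝ := fun p c => ∑ a, if c ∈ L a then p a else 0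
  let Q : (α → ℝ) → ℝ := fun p => ∑ c, z p c ^ 2
  have hzadd : ∀ (p q : α → ℝ) (t : ℝ) c, z ((1 - t) • p + t • q) c
      = z p c + t * (z q c - z p c) := by
    intro p q t c
    simp only [z, mul_sub, mul_sum, ← sum_sub_distrib, ← sum_add_distrib]
    refine sum_congr rfl fun a _ => ?_
    split_ifs
    · simp only [Pi.add_apply, Pi.smul_apply, smul_eq_mul]
      ring
    · simp
  have hQc : Continuous Q := by
    refine continuous_finsetSum _ fun c _ => Continuous.pow ?_ 2
    refine continuous_finsetSum _ fun a _ => ?_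
    split_ifs
    · exact continuous_apply a
    · exact continuous_const
  let u : α → ℝ := fun _ => 1 / Fintype.card α
  have hu : u ∈ stdSimplex ℝ α := by
    refine ⟨fun _ => by positivity, ?_⟩
    simp only [u, sum_const, card_univ, nsmul_eq_mul]
    field_simp
  have hzu : ∀ c, z u c < 1 / 2 := by
    intro c
    have := hcon c
    unfold density at this
    simp only [z, u]
    rw [← sum_filter, sum_const, nsmul_eq_mul, mul_one_div]
    exact this
  have hznn : ∀ p ∈ stdSimplex ℝ α, ∀ c, 0 ≤ z p c := by
    intro p hp c
    refine sum_nonneg fun a _ => ?_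
    split_ifs
    · exact hp.1 a
    · exact le_rfl
  obtain ⟨p, hp, hmin⟩ := (isCompact_stdSimplex ℝ α).exists_isMinOn ⟨u, hu⟩ hQc.continuousOn
  have hfirst : ∀ q ∈ stdSimplex ℝ α, Q p ≤ ∑ c, z p c * z q c := by
    intro q hq
    have hder : ∀ t : ℝ, 0 < t → t ≤ 1 →
        0 ≤ 2 * (∑ c, z p c * (z q c - z p c)) + t * ∑ c, (z q c - z p c) ^ 2 := by
      intro t ht ht1
      have hmem : (1 - t) • p + t • q ∈ stdSimplex ℝ α :=
        convex_stdSimplex ℝ α hp hq (by linarith) ht.le (by ring)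
      have h1 : Q p ≤ Q ((1 - t) • p + t • q) := hmin hmem
      have h2 : Q ((1 - t) • p + t • q) = Q p +
          t * (2 * (∑ c, z p c * (z q c - z p c)) + t * ∑ c, (z q c - z p c) ^ 2) := by
        simp only [Q, hzadd, mul_sum, ← sum_add_distrib]
        refine sum_congr rfl fun c _ => ?_
        ring
      rw [h2] at h1
      have : 0 ≤ t * (2 * (∑ c, z p c * (z q c - z p c)) + t * ∑ c, (z q c - z p c) ^ 2) := by
        linarith
      exact (mul_nonneg_iff_of_pos_left ht).1 this
    have hlim : 0 ≤ ∑ c, z p c * (z q c - z p c) := by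
      set a := ∑ c, z p c * (z q c - z p c)
      set b := ∑ c, (z q c - z p c) ^ 2
      have hb : 0 ≤ b := sum_nonneg fun _ _ => sq_nonneg _
      by_contra ha
      push Not at ha
      -- With t = 1 this gives b ≥ -2a > 0, so t = -a/b is admissible; there `hder` reads 0 ≤ a.
      have h1 := hder 1 one_pos le_rfl
      have hbp : 0 < b := by linarith
      have h2 := hder (-a / b) (by apply div_pos <;> linarith) (by
        rw [div_le_one hbp]; linarith)
      rw [div_mul_cancel₀ _ hbp.ne'] at h2
      linarith
    have : ∑ c, z p c * (z q c - z p c) = (∑ c, z p c * z q c) - Q p := by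
      simp only [Q, ← sum_sub_distrib]
      refine sum_congr rfl fun c _ => ?_
      ring
    linarith
  let g : α → ℝ := fun a => ∑ c ∈ L a, z p c
  have hg : ∀ a, Q p ≤ g a := by
    intro a
    have h1 := hfirst (Pi.single a 1) (single_mem_stdSimplex ℝ a)
    have h2 : ∀ c, z (Pi.single a 1) c = if c ∈ L a then 1 else 0 := by
      intro c
      simp only [z]
      rw [sum_eq_single a]
      · simp
      · intro b _ hb
        simp [hb]
      · simp
    simpa [h2, g] using h1
  have hbil : ∀ F : γ → ℝ, ∑ c, F c * z p c = ∑ a, p a * ∑ c ∈ L a, F c := by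
    intro F
    simp only [z, mul_sum]
    rw [sum_comm]
    refine sum_congr rfl fun a _ => ?_
    rw [← sum_filter_add_sum_filter_not univ (fun c => c ∈ L a)]
    rw [sum_congr rfl (g := fun c => p a * F c), sum_congr (s₁ := filter (fun c => c ∉ L a) univ) rfl
      (g := fun c => 0)]
    · simp
    · intro c hc
      simp [(mem_filter.1 hc).2]
    · intro c hc
      simp [(mem_filter.1 hc).2, mul_comm]
  have hQg : Q p = ∑ a, p a * g a := by
    rw [← hbil]
    simp only [Q, sq]
  -- Complementary slackness: `Q p` is the p-average of the values `g a`, none of which is smaller.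
  have htight : ∀ a, p a * (g a - Q p) = 0 := by
    have hs : ∑ a, p a * (g a - Q p) = 0 := by
      simp only [mul_sub, sum_sub_distrib, ← hQg, ← sum_mul, hp.2]
      ring
    intro a
    exact (sum_eq_zero_iff_of_nonneg fun a _ => mul_nonneg (hp.1 a) (by linarith [hg a])).1 hs a
      (mem_univ a)
  have hzpos : ∃ c, 0 < z p c := by
    obtain ⟨a, ha⟩ : ∃ a, 0 < p a := by
      by_contra hh
      push Not at hh
      have := sum_nonpos fun a (_ : a ∈ univ) => hh a
      rw [hp.2] at this
      linarith
    obtain ⟨c, hc⟩ := hne a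
    refine ⟨c, ha.trans_le ?_⟩
    have := single_le_sum (f := fun a => if c ∈ L a then p a else 0)
      (fun a _ => by
        split_ifs
        · exact hp.1 a
        · exact le_rfl) (mem_univ a)
    simpa [hc] using this
  have hQlt : 2 * Q p < ∑ c, z p c := by
    have h1 := hfirst u hu
    have h2 : ∑ c, z p c * z u c < ∑ c, z p c * (1 / 2) := by
      obtain ⟨c, hc⟩ := hzpos
      refine sum_lt_sum (fun c _ => mul_le_mul_of_nonneg_left (hzu c).le (hznn p hp c))
        ⟨c, mem_univ c, mul_lt_mul_of_pos_left (hzu c) hc⟩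
    rw [← sum_mul] at h2
    linarith
  -- If two sets of the support covered everything, then 2 `Q p` = `g a` + `g a'` would be at least
  -- the total of `z p`, contrary to `hQlt`.
  have hpair : ∀ a a', 0 < p a → 0 < p a' → 1 / 4 ≤ density (L a ∩ L a') := by
    intro a a' ha ha'
    apply hL
    by_contra hh
    push Not at hh
    have e1 : g a = Q p := by
      rcases mul_eq_zero.1 (htight a) with h | h <;> linarith
    have e2 : g a' = Q p := by
      rcases mul_eq_zero.1 (htight a') with h | h <;> linarith
    have hun : L a ∪ L a' = univ := by
      refine eq_univ_of_forall fun c => mem_union.2 ?_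
      by_cases hc : c ∈ L a
      · exact Or.inl hc
      · exact Or.inr (hh c hc)
    have h1 := sum_union_inter (s₁ := L a) (s₂ := L a') (f := z p)
    rw [hun] at h1
    have h2 : 0 ≤ ∑ c ∈ L a ∩ L a', z p c := sum_nonneg fun c _ => hznn p hp c
    simp only [g] at e1 e2
    linarith
  -- `Q p` is the expected size of the intersection of two independent random sets, whereas the
  -- uniform distribution has all its `z` below 1/2 and so gives less than a quarter.
  have hQge : (Fintype.card γ : ℝ) / 4 ≤ Q p := by
    have h1 : ∀ a, p a * ((Fintype.card γ : ℝ) / 4) ≤ p a * g a := by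
      intro a
      rcases (hp.1 a).eq_or_lt with h | h
      · rw [← h]; simp
      · refine mul_le_mul_of_nonneg_left ?_ h.le
        have h3 : g a = ∑ a', p a' * ((L a ∩ L a').card : ℝ) := by
          have := hbil fun c => if c ∈ L a then 1 else 0
          simp only [ite_mul, one_mul, zero_mul, sum_ite_mem, univ_inter] at this
          rw [show g a = ∑ c ∈ L a, z p c from rfl, this]
          refine sum_congr rfl fun a' _ => ?_
          simp [inter_comm]
        rw [h3]
        have h4 : (Fintype.card γ : ℝ) / 4 = ∑ a', p a' * ((Fintype.card γ : ℝ) / 4) := by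
          rw [← sum_mul, hp.2, one_mul]
        rw [h4]
        refine sum_le_sum fun a' _ => ?_
        rcases (hp.1 a').eq_or_lt with h' | h'
        · rw [← h']; simp
        · refine mul_le_mul_of_nonneg_left ?_ h'.le
          have := hpair a a' h h'
          unfold density at this
          rw [le_div_iff₀ hγ] at this
          linarith
    have h2 := sum_le_sum fun a (_ : a ∈ univ) => h1 a
    rw [← sum_mul, hp.2, one_mul, ← hQg] at h2
    exact h2
  have hQu : Q u < Fintype.card γ / 4 := by
    have : Q u < ∑ _c : γ, (1 / 4 : ℝ) := by
      refine sum_lt_sum_of_nonempty univ_nonempty fun c _ => ?_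
      nlinarith [hzu c, hznn u hu c]
    simp only [sum_const, card_univ, nsmul_eq_mul] at this
    linarith
  have : Q p ≤ Q u := hmin hu
  linarith

end Tripartite

/-! ### No vertex of C reaches half of A: links, and the ranges with y ≥ 1/4 -/

namespace Tripartite

variable {α β γ : Type*} [Fintype α] [Fintype β] [Fintype γ]
  [DecidableEq α] [DecidableEq β] [DecidableEq γ]

/-- The elements of `α` whose neighbourhood `P` meets the neighbourhood `N` of `c`. -/
def reach (P : α → Finset β) (N : γ → Finset β) (c : γ) : Finset α :=
  univ.filter fun a => ¬ Disjoint (P a) (N c)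

/-- Two elements of `γ` are linked if they have a common neighbour. -/
def Linked (N : γ → Finset β) (c c' : γ) : Prop := ¬ Disjoint (N c) (N c')

/-- The degree conditions of an `(x, y)`-biconstrained graph, where the neighbourhoods in `β` of
the elements of `α` and of `γ` are given by `P` and `N`, and no element of `γ` reaches half
of `α`. -/
structure HalfFree (P : α → Finset β) (N : γ → Finset β) (x y : ℝ) : Prop where
  pos : 0 < y
  deg_P : ∀ a, x ≤ density (P a)
  deg_N : ∀ c, y ≤ density (N c)
  deg_left : ∀ b, x ≤ density (univ.filter fun a => b ∈ P a)
  deg_right : ∀ b, y ≤ density (univ.filter fun c => b ∈ N c)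
  reach_lt : ∀ c, density (reach P N c) < 1 / 2

theorem mem_reach {P : α → Finset β} {N : γ → Finset β} {a : α} {c : γ} :
    a ∈ reach P N c ↔ ∃ b, b ∈ P a ∧ b ∈ N c := by
  simp [reach, not_disjoint_iff]

theorem notMem_reach {P : α → Finset β} {N : γ → Finset β} {a : α} {c : γ} :
    a ∉ reach P N c ↔ Disjoint (P a) (N c) := by
  simp [reach]

theorem Linked.symm {N : γ → Finset β} {c c' : γ} (h : Linked N c c') : Linked N c' c :=
  fun hd => h hd.symm

theorem not_linked {N : γ → Finset β} {c c' : γ} : ¬ Linked N c c' ↔ Disjoint (N c) (N c') :=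
  not_not

namespace HalfFree

variable {P : α → Finset β} {N : γ → Finset β} {x y : ℝ} [Nonempty α] [Nonempty β] [Nonempty γ]

theorem nonempty_N (H : HalfFree P N x y) (c : γ) : (N c).Nonempty :=
  nonempty_of_density_pos (H.pos.trans_le (H.deg_N c))

theorem linked_self (H : HalfFree P N x y) (c : γ) : Linked N c c := by
  intro h
  rw [disjoint_self_iff_empty] at h
  exact (H.nonempty_N c).ne_empty h

theorem exists_mem_N (H : HalfFree P N x y) (b : β) : ∃ c, b ∈ N c := by
  obtain ⟨c, hc⟩ := nonempty_of_density_pos (H.pos.trans_le (H.deg_right b))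
  exact ⟨c, (mem_filter.1 hc).2⟩

theorem density_le_of_disjoint (H : HalfFree P N x y) {a : α} {X : Finset β}
    (h : Disjoint (P a) X) : density X ≤ 1 - x := by
  have := density_add_le_one h
  linarith [H.deg_P a]

theorem density_union₂_le (H : HalfFree P N x y) {a : α} {u v : γ} (hu : a ∉ reach P N u)
    (hv : a ∉ reach P N v) : density (N u ∪ N v) ≤ 1 - x :=
  H.density_le_of_disjoint (disjoint_union_right.2 ⟨notMem_reach.1 hu, notMem_reach.1 hv⟩)

theorem density_union₃_le (H : HalfFree P N x y) {a : α} {u v w : γ} (hu : a ∉ reach P N u)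
    (hv : a ∉ reach P N v) (hw : a ∉ reach P N w) : density (N u ∪ N v ∪ N w) ≤ 1 - x :=
  H.density_le_of_disjoint (disjoint_union_right.2
    ⟨disjoint_union_right.2 ⟨notMem_reach.1 hu, notMem_reach.1 hv⟩, notMem_reach.1 hw⟩)

/-- Two reached sets, each below one half, cannot cover A. -/
theorem density_pair_le (H : HalfFree P N x y) (u v : γ) : density (N u ∪ N v) ≤ 1 - x := by
  have h : density (reach P N u ∪ reach P N v) < 1 := by
    have := density_union_le (reach P N u) (reach P N v)
    linarith [H.reach_lt u, H.reach_lt v]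
  obtain ⟨a, ha⟩ := exists_notMem_of_density_lt_one h
  rw [mem_union, not_or] at ha
  exact H.density_union₂_le ha.1 ha.2

/-- Among any four elements of `γ`, some three have a small joint neighbourhood. -/
theorem four_elements (H : HalfFree P N x y) (p q r s : γ) :
    density (N p ∪ N q ∪ N r) ≤ 1 - x ∨ density (N p ∪ N q ∪ N s) ≤ 1 - x ∨
      density (N p ∪ N r ∪ N s) ≤ 1 - x ∨ density (N q ∪ N r ∪ N s) ≤ 1 - x := by
  -- With unit weights, some a reaches at most one of the four.
  obtain ⟨a, ha⟩ := exists_weight_lt_half (reach P N) H.reach_lt ![p, q, r, s] (fun _ => 1)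
    (fun _ => zero_le_one) (by simp)
  simp only [Fin.sum_univ_four, Matrix.cons_val_zero, Matrix.cons_val_one, Matrix.cons_val] at ha
  by_cases hp : a ∈ reach P N p <;> by_cases hq : a ∈ reach P N q <;>
    by_cases hr : a ∈ reach P N r <;> by_cases hs : a ∈ reach P N s <;>
    simp only [hp, hq, hr, hs, if_true, if_false] at ha <;> norm_num at ha
  · exact Or.inr (Or.inr (Or.inr (H.density_union₃_le hq hr hs)))
  · exact Or.inr (Or.inr (Or.inl (H.density_union₃_le hp hr hs)))
  · exact Or.inr (Or.inl (H.density_union₃_le hp hq hs))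
  · exact Or.inl (H.density_union₃_le hp hq hr)
  · exact Or.inl (H.density_union₃_le hp hq hr)

/-- Adding an element linked to a previous one increases the reached set by less than
`1 / 2 - x`. -/
theorem density_union_reach_lt (H : HalfFree P N x y) {T : Finset α} {w w' : γ}
    (hw : reach P N w' ⊆ T) (h : Linked N w' w) :
    density (T ∪ reach P N w) < density T + (1 / 2 - x) := by
  obtain ⟨b, hb', hb⟩ := not_disjoint_iff.1 h
  have h1 := density_union_add_inter T (reach P N w)
  have h2 : (univ.filter fun a => b ∈ P a) ⊆ T ∩ reach P N w := by
    intro a ha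
    have ha := (mem_filter.1 ha).2
    exact mem_inter.2 ⟨hw (mem_reach.2 ⟨b, ha, hb'⟩), mem_reach.2 ⟨b, ha, hb⟩⟩
  linarith [density_mono h2, H.deg_left b, H.reach_lt w]

theorem density_reach_sdiff_le (H : HalfFree P N x y) {v w : γ} (h : Linked N v w) :
    density (reach P N w \ reach P N v) ≤ 1 / 2 - x := by
  have h1 := H.density_union_reach_lt (Subset.refl (reach P N v)) h
  have h2 := density_union_of_disjoint (disjoint_sdiff (s := reach P N v) (t := reach P N w))
  rw [union_sdiff_self_eq_union] at h2
  linarith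

/-- Two links give a reached set of density below 1/2 + 2(1/2 - x), which is at most 1 when x ≥ 1/4;
so one a misses all three. -/
theorem density_path₃_le (H : HalfFree P N x y) (hx : 1 / 4 ≤ x) {u m v : γ}
    (h1 : Linked N u m) (h2 : Linked N m v) : density (N u ∪ N m ∪ N v) ≤ 1 - x := by
  have e1 := H.density_union_reach_lt (Subset.refl (reach P N u)) h1
  have e2 := H.density_union_reach_lt (subset_union_right (s₁ := reach P N u)) h2
  obtain ⟨a, ha⟩ := exists_notMem_of_density_lt_one
    (s := reach P N u ∪ reach P N m ∪ reach P N v) (by linarith [H.reach_lt u])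
  simp only [mem_union, not_or] at ha
  exact H.density_union₃_le ha.1.1 ha.1.2 ha.2

/-- Five vertices joined in a tree by four links reach less than 1/2 + 4(1/2 - x) ≤ 1. The vertices
m and t only provide the connection. -/
theorem density_path₃_add_le (H : HalfFree P N x y) (hx : 3 / 8 ≤ x) {u m v t : γ}
    (h1 : Linked N u m) (h2 : Linked N m v)
    (ht : Linked N u t ∨ Linked N v t ∨ Linked N m t) {z : γ} (hz : Linked N t z) :
    density (N u ∪ N v ∪ N z) ≤ 1 - x := by
  have e1 := H.density_union_reach_lt (Subset.refl (reach P N u)) h1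
  have e2 := H.density_union_reach_lt (subset_union_right (s₁ := reach P N u)) h2
  have e3 : density (reach P N u ∪ reach P N m ∪ reach P N v ∪ reach P N t) <
      density (reach P N u ∪ reach P N m ∪ reach P N v) + (1 / 2 - x) := by
    rcases ht with h | h | h
    · exact H.density_union_reach_lt (subset_union_left.trans subset_union_left) h
    · exact H.density_union_reach_lt subset_union_right h
    · exact H.density_union_reach_lt (subset_union_right.trans subset_union_left) h
  have e4 := H.density_union_reach_lt (subset_union_right
    (s₁ := reach P N u ∪ reach P N m ∪ reach P N v)) hz
  obtain ⟨a, ha⟩ := exists_notMem_of_density_lt_one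
    (s := reach P N u ∪ reach P N m ∪ reach P N v ∪ reach P N t ∪ reach P N z)
    (by linarith [H.reach_lt u])
  simp only [mem_union, not_or] at ha
  exact H.density_union₃_le ha.1.1.1.1 ha.1.1.2 ha.2

theorem exists_density_inter_ge (H : HalfFree P N x y) (X : Finset β) :
    ∃ c, y * density X ≤ density (X ∩ N c) := by
  obtain ⟨c, -, hc⟩ := exists_max_image (univ : Finset γ) (fun c => density (X ∩ N c))
    univ_nonempty
  refine ⟨c, ?_⟩
  have := density_double_count (fun c b => b ∈ N c) univ X (p := y) (q := density (X ∩ N c))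
    (fun b _ => H.deg_right b) (fun c' _ => by
      rw [filter_mem_eq_inter]
      exact hc c' (mem_univ _))
  rwa [density_univ, mul_one] at this

/-- Disjoint neighbourhoods would have a union of density 2y > 1 - x, so all pairs are linked. Each
greedy choice leaves at most a factor 1 - y of B uncovered. -/
theorem false_of_pow_lt (H : HalfFree P N x y) (hx : 1 / 4 ≤ x) (hxy : 1 < x + 2 * y)
    (hpow : (1 - y) ^ 3 < x) : False := by
  have hl : ∀ u v, Linked N u v := by
    intro u v hd
    have h1 := H.density_pair_le u v
    rw [density_union_of_disjoint hd] at h1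
    linarith [H.deg_N u, H.deg_N v]
  have hy1 : y ≤ 1 := by
    obtain ⟨c⟩ := ‹Nonempty γ›
    have := density_mono (subset_univ (N c))
    rw [density_univ] at this
    linarith [H.deg_N c]
  have step : ∀ X : Finset β, ∃ c, density (X \ N c) ≤ (1 - y) * density X := by
    intro X
    obtain ⟨c, hc⟩ := H.exists_density_inter_ge X
    exact ⟨c, by linarith [density_sdiff_add_inter X (N c)]⟩
  obtain ⟨u, hu⟩ := step univ
  obtain ⟨v, hv⟩ := step (univ \ N u)
  obtain ⟨w, hw⟩ := step ((univ \ N u) \ N v)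
  have h1 := H.density_path₃_le hx (hl u v) (hl v w)
  have h2 := density_compl (N u ∪ N v ∪ N w)
  have h3 : (N u ∪ N v ∪ N w)ᶜ = ((univ \ N u) \ N v) \ N w := by
    ext b
    simp [and_assoc]
  rw [h3] at h2
  rw [density_univ] at hu
  have h4 : 0 ≤ 1 - y := by linarith
  nlinarith [mul_le_mul_of_nonneg_left hu h4, mul_le_mul_of_nonneg_left hv h4,
    mul_le_mul_of_nonneg_left (mul_le_mul_of_nonneg_left hu h4) h4]

/-- If a and a' both miss c, their neighbourhoods lie in a set of density at most 1 - y < 2x, hence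
share some b. Both then reach every neighbour of b in C, which is at least a quarter of C. -/
theorem false_of_quarter_le (H : HalfFree P N x y) (hx : 0 < x) (hy : 1 / 4 ≤ y)
    (hxy : 1 < 2 * x + y) : False := by
  obtain ⟨c, hc⟩ := exists_half_le_density (fun a => univ.filter fun c => a ∈ reach P N c)
    (by
      intro a
      obtain ⟨b, hb⟩ := nonempty_of_density_pos (hx.trans_le (H.deg_P a))
      obtain ⟨c, hc⟩ := H.exists_mem_N b
      exact ⟨c, mem_filter.2 ⟨mem_univ _, mem_reach.2 ⟨b, hb, hc⟩⟩⟩)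
    (by
      rintro a a' ⟨c, hc, hc'⟩
      simp only [mem_filter, mem_univ, true_and, notMem_reach] at hc hc'
      have h1 := density_add_le_one (disjoint_union_left.2 ⟨hc, hc'⟩)
      have h2 := density_union_add_inter (P a) (P a')
      obtain ⟨b, hb⟩ := nonempty_of_density_pos (s := P a ∩ P a') (by
        linarith [H.deg_P a, H.deg_P a', H.deg_N c])
      rw [mem_inter] at hb
      refine hy.trans ((H.deg_right b).trans (density_mono fun d hd => ?_))
      have hd := (mem_filter.1 hd).2
      simp only [mem_inter, mem_filter, mem_univ, true_and]
      exact ⟨mem_reach.2 ⟨b, hb.1, hd⟩, mem_reach.2 ⟨b, hb.2, hd⟩⟩)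
  have : (univ.filter fun a => c ∈ univ.filter fun c => a ∈ reach P N c) = reach P N c := by
    ext a; simp
  rw [this] at hc
  linarith [H.reach_lt c]

end HalfFree
end Tripartite

/-! ### Splitting C into two parts with no links between them -/

namespace Tripartite

variable {α β γ : Type*} [Fintype α] [Fintype β] [Fintype γ]
  [DecidableEq α] [DecidableEq β] [DecidableEq γ]

/-- A set of elements of `γ` none of which is linked to an element outside the set. -/
def Separated (N : γ → Finset β) (D : Finset γ) : Prop :=
  ∀ c ∈ D, ∀ c' ∉ D, ¬ Linked N c c'

theorem Separated.compl {N : γ → Finset β} {D : Finset γ} (h : Separated N D) :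
    Separated N Dᶜ := by
  intro c hc c' hc' hl
  rw [mem_compl] at hc hc'
  exact h c' (not_not.1 hc') c hc hl.symm

theorem Separated.mem {N : γ → Finset β} {D : Finset γ} (h : Separated N D) {b : β} {c c' : γ}
    (hc : c ∈ D) (hb : b ∈ N c) (hb' : b ∈ N c') : c' ∈ D := by
  by_contra hc'
  exact h c hc c' hc' (not_disjoint_iff.2 ⟨b, hb, hb'⟩)

/-- The part of `D` that is reached from `a`. -/
def reachIn (P : α → Finset β) (N : γ → Finset β) (D : Finset γ) (a : α) : Finset γ :=
  D.filter fun c => a ∈ reach P N c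

namespace HalfFree

variable {P : α → Finset β} {N : γ → Finset β} {x y : ℝ} [Nonempty α] [Nonempty β] [Nonempty γ]

theorem mem_biUnion_or (H : HalfFree P N x y) (D : Finset γ) (b : β) :
    b ∈ D.biUnion N ∨ b ∈ Dᶜ.biUnion N := by
  obtain ⟨c, hc⟩ := H.exists_mem_N b
  by_cases hD : c ∈ D
  · exact Or.inl (mem_biUnion.2 ⟨c, hD, hc⟩)
  · exact Or.inr (mem_biUnion.2 ⟨c, mem_compl.2 hD, hc⟩)

theorem le_density_reachIn (H : HalfFree P N x y) {D : Finset γ} (hD : Separated N D) {a : α}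
    {b : β} (hb : b ∈ P a) (hbD : b ∈ D.biUnion N) : y ≤ density (reachIn P N D a) := by
  obtain ⟨c, hc, hbc⟩ := mem_biUnion.1 hbD
  refine (H.deg_right b).trans (density_mono fun c' hc' => ?_)
  have hc' := (mem_filter.1 hc').2
  exact mem_filter.2 ⟨hD.mem hc hbc hc', mem_reach.2 ⟨b, hb, hc'⟩⟩

theorem le_density_of_separated (H : HalfFree P N x y) {D : Finset γ} (hD : Separated N D)
    (hne : D.Nonempty) : y ≤ density D := by
  obtain ⟨c, hc⟩ := hne
  obtain ⟨b, hb⟩ := H.nonempty_N c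
  exact (H.deg_right b).trans (density_mono fun c' hc' => hD.mem hc hb (mem_filter.1 hc').2)

/-- If the elements of a separated set reach almost the same part of `α` as some `v`, then not much
more than half of `α` reaches the set. -/
theorem density_reaching_lt (H : HalfFree P N x y) {D : Finset γ} (hD : Separated N D)
    (v : γ) {k : ℝ} (hk : ∀ t ∈ D, density (reach P N t \ reach P N v) ≤ k) :
    y * (density (univ.filter fun a => ∃ c ∈ D, a ∈ reach P N c) - 1 / 2) < k * density D := by
  set X : Finset α := univ.filter fun a => a ∉ reach P N v ∧ ∃ c ∈ D, a ∈ reach P N c with hX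
  -- A vertex a reaching D has a neighbour b all of whose C-neighbours lie in D, so it reaches at
  -- least y of C inside D.
  have h1 := density_double_count (fun c a => a ∈ reach P N c) D X (p := y) (q := k)
    (by
      intro a ha
      obtain ⟨-, -, c, hc, hac⟩ := mem_filter.1 ha
      obtain ⟨b, hb, hbc⟩ := mem_reach.1 hac
      exact H.le_density_reachIn hD hb (mem_biUnion.2 ⟨c, hc, hbc⟩))
    (by
      intro c hc
      refine (density_mono fun a ha => ?_).trans (hk c hc)
      rw [mem_filter, hX, mem_filter] at ha
      exact mem_sdiff.2 ⟨ha.2, ha.1.2.1⟩)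
  have h2 : density (univ.filter fun a => ∃ c ∈ D, a ∈ reach P N c)
      ≤ density (reach P N v) + density X := by
    refine (density_mono fun a ha => ?_).trans (density_union_le _ _)
    by_cases hv : a ∈ reach P N v
    · exact mem_union_left _ hv
    · exact mem_union_right _ (mem_filter.2 ⟨mem_univ _, hv, (mem_filter.1 ha).2⟩)
  nlinarith [H.reach_lt v, H.pos]

/-- The part of A reaching D has density below 1/2 + k |D| / y, with |D| the density of D, and this
is at most 1. -/
theorem exists_not_reaching (H : HalfFree P N x y) {D : Finset γ} (hD : Separated N D)
    (v : γ) {k : ℝ} (hk : ∀ t ∈ D, density (reach P N t \ reach P N v) ≤ k)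
    (hle : 2 * (k * density D) ≤ y) : ∃ a, ∀ c ∈ D, a ∉ reach P N c := by
  have h := H.density_reaching_lt hD v hk
  obtain ⟨a, ha⟩ := exists_notMem_of_density_lt_one
    (s := univ.filter fun a => ∃ c ∈ D, a ∈ reach P N c) (by nlinarith [H.pos])
  refine ⟨a, fun c hc hac => ha (mem_filter.2 ⟨mem_univ _, c, hc, hac⟩)⟩

theorem density_biUnion_le (H : HalfFree P N x y) {D : Finset γ} {a : α}
    (ha : ∀ c ∈ D, a ∉ reach P N c) : density (D.biUnion N) ≤ 1 - x :=
  H.density_le_of_disjoint ((disjoint_biUnion_right _ _ _).2 fun c hc => notMem_reach.1 (ha c hc))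

/-- A missed c in D would place the disjoint sets `P a` and `N c`, of total density at least x + y >
1 - x, in the neighbourhood of D. -/
theorem reachIn_eq_self (H : HalfFree P N x y) (hxy : 1 < 2 * x + y) {D : Finset γ}
    (hD : density (D.biUnion N) ≤ 1 - x) {a : α} (ha : P a ⊆ D.biUnion N) :
    reachIn P N D a = D := by
  refine filter_true_of_mem fun c hc => ?_
  by_contra hac
  have h1 := density_union_of_disjoint (notMem_reach.1 hac)
  have h2 := density_mono (union_subset ha (subset_biUnion_of_mem N hc))
  linarith [H.deg_P a, H.deg_N c]

/-- If `C` splits into two separated parts, in the first of which pairs have small joint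
neighbourhoods, then the proportions reached by `a` in both parts sum to at least one. -/
theorem one_le_add_reachIn (H : HalfFree P N x y) (hxy : 1 < 2 * x + y) {r : ℝ} (hr : r ^ 2 ≤ y)
    (hry : (1 - x - 2 * y) * (1 - r) ^ 2 ≤ y * (2 * x + y - 1))
    {D : Finset γ} (hD : Separated N D) (hne : D.Nonempty) (hne' : Dᶜ.Nonempty)
    (h1 : density (D.biUnion N) ≤ 1 - x) (h2 : density (Dᶜ.biUnion N) ≤ 1 - x)
    (hpair : ∀ c ∈ D, ∀ c' ∈ D, density (N c ∪ N c') ≤ 1 - x - y) (a : α) :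
    1 ≤ density (reachIn P N D a) / density D + density (reachIn P N Dᶜ a) / density Dᶜ := by
  have hg := density_pos hne
  have hg' := density_pos hne'
  have hnn := div_nonneg (density_nonneg (reachIn P N D a)) hg.le
  have hnn' := div_nonneg (density_nonneg (reachIn P N Dᶜ a)) hg'.le
  by_cases hfull : reachIn P N D a = D
  · rw [hfull, div_self hg.ne'] at *
    linarith
  by_cases hfull' : reachIn P N Dᶜ a = Dᶜ
  · rw [hfull', div_self hg'.ne'] at *
    linarith
  have hsub : ¬ P a ⊆ D.biUnion N := fun h => hfull (H.reachIn_eq_self hxy h1 h)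
  have hsub' : ¬ P a ⊆ Dᶜ.biUnion N := fun h => hfull' (H.reachIn_eq_self hxy h2 h)
  obtain ⟨c₁, hc₁, hac₁⟩ : ∃ c ∈ D, a ∉ reach P N c := by
    by_contra hh
    push Not at hh
    exact hfull (filter_true_of_mem hh)
  obtain ⟨c₂, hc₂, hac₂⟩ : ∃ c ∈ Dᶜ, a ∉ reach P N c := by
    by_contra hh
    push Not at hh
    exact hfull' (filter_true_of_mem hh)
  obtain ⟨b, hb, hbD⟩ := not_subset.1 hsub
  have hl' : y ≤ density (reachIn P N Dᶜ a) :=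
    H.le_density_reachIn hD.compl hb ((H.mem_biUnion_or D b).resolve_left hbD)
  set Y := P a ∩ D.biUnion N with hY
  -- The rest of `P a` shares the other side of B, of density at most 1 - x, with the disjoint set
  -- `N c₂`.
  have hYge : 2 * x + y - 1 ≤ density Y := by
    have e1 := density_sdiff_add_inter (P a) (D.biUnion N)
    have hd : Disjoint (P a \ D.biUnion N) (N c₂) :=
      (notMem_reach.1 hac₂).mono_left sdiff_subset
    have e2 := density_union_of_disjoint hd
    have e3 : density (P a \ D.biUnion N ∪ N c₂) ≤ density (Dᶜ.biUnion N) := by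
      refine density_mono (union_subset (fun b hb => ?_) (subset_biUnion_of_mem N hc₂))
      exact (H.mem_biUnion_or D b).resolve_left (mem_sdiff.1 hb).2
    linarith [H.deg_P a, H.deg_N c₂]
  -- Each c in D meets Y in at most 1 - x - 2y, because `N c₁` avoids Y and the joint neighbourhood
  -- of c and c₁ is at most 1 - x - y.
  have hdc := density_double_count (fun c b => b ∈ N c) (reachIn P N D a) Y
    (p := y) (q := 1 - x - 2 * y)
    (by
      intro b hb
      obtain ⟨hbP, hbD⟩ := mem_inter.1 hb
      obtain ⟨c, hc, hbc⟩ := mem_biUnion.1 hbD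
      refine (H.deg_right b).trans (density_mono fun c' hc' => ?_)
      have hc' := (mem_filter.1 hc').2
      exact mem_filter.2
        ⟨mem_filter.2 ⟨hD.mem hc hbc hc', mem_reach.2 ⟨b, hbP, hc'⟩⟩, hc'⟩)
    (by
      intro c hc
      have hcD := (mem_filter.1 hc).1
      have hd : Disjoint (Y.filter fun b => b ∈ N c) (N c₁) :=
        (notMem_reach.1 hac₁).mono_left ((filter_subset _ _).trans inter_subset_left)
      have e1 := density_union_of_disjoint hd
      have e2 : density ((Y.filter fun b => b ∈ N c) ∪ N c₁) ≤ density (N c ∪ N c₁) :=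
        density_mono (union_subset_union_left fun b hb => (mem_filter.1 hb).2)
      linarith [hpair c hcD c₁ hc₁, H.deg_N c₁])
  have hcompl := density_compl D
  set l := density (reachIn P N D a)
  set l' := density (reachIn P N Dᶜ a)
  set g := density D
  have hy := H.pos
  have hll : y * (2 * x + y - 1) ≤ (1 - x - 2 * y) * l := by nlinarith
  have hlnn : 0 ≤ l := density_nonneg _
  have heps : 0 < 1 - x - 2 * y := by
    by_contra hh
    push Not at hh
    nlinarith [mul_pos hy (by linarith : 0 < 2 * x + y - 1)]
  have hlr : (1 - r) ^ 2 ≤ l := by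
    have : (1 - x - 2 * y) * (1 - r) ^ 2 ≤ (1 - x - 2 * y) * l := hry.trans hll
    exact le_of_mul_le_mul_left this heps
  rw [hcompl] at hg' ⊢
  rw [div_add_div _ _ hg.ne' hg'.ne', le_div_iff₀ (mul_pos hg hg')]
  -- Cauchy–Schwarz: (1 - r)² / g + r² / (1 - g) ≥ 1.
  nlinarith [sq_nonneg (g - (1 - r)), mul_le_mul_of_nonneg_right hlr hg'.le,
    mul_le_mul_of_nonneg_left (hr.trans hl') hg.le]

/-- There is no partition of `γ` into two separated parts each of which is missed by some
element of `α`. -/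
theorem false_of_separated (H : HalfFree P N x y) (hxy : 1 < 2 * x + y) {r : ℝ} (hr : r ^ 2 ≤ y)
    (hry : (1 - x - 2 * y) * (1 - r) ^ 2 ≤ y * (2 * x + y - 1))
    {D : Finset γ} (hD : Separated N D) {a a' : α}
    (ha : ∀ c ∈ D, a ∉ reach P N c) (ha' : ∀ c ∈ Dᶜ, a' ∉ reach P N c) (hx : 0 < x) : False := by
  have hreach : ∀ a, ∃ c, a ∈ reach P N c := by
    intro a
    obtain ⟨b, hb⟩ := nonempty_of_density_pos (hx.trans_le (H.deg_P a))
    obtain ⟨c, hc⟩ := H.exists_mem_N b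
    exact ⟨c, mem_reach.2 ⟨b, hb, hc⟩⟩
  have hne : D.Nonempty := by
    obtain ⟨c, hc⟩ := hreach a'
    refine ⟨c, ?_⟩
    by_contra hh
    exact ha' c (mem_compl.2 hh) hc
  have hne' : Dᶜ.Nonempty := by
    obtain ⟨c, hc⟩ := hreach a
    exact ⟨c, mem_compl.2 fun hh => ha c hh hc⟩
  have h1 := H.density_biUnion_le ha
  have h2 := H.density_biUnion_le ha'
  have hall : ∀ a, 1 ≤ density (reachIn P N D a) / density D +
      density (reachIn P N Dᶜ a) / density Dᶜ := by
    intro a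
    -- Only one part can contain a pair with large joint neighbourhood: with such pairs in both,
    -- every three of the four vertices would exceed 1 - x, against `four_elements`.
    by_cases hpair : ∀ c ∈ D, ∀ c' ∈ D, density (N c ∪ N c') ≤ 1 - x - y
    · exact H.one_le_add_reachIn hxy hr hry hD hne hne' h1 h2 hpair a
    · push Not at hpair
      obtain ⟨p, hp, q, hq, hpq⟩ := hpair
      have hpair' : ∀ c ∈ Dᶜ, ∀ c' ∈ Dᶜ, density (N c ∪ N c') ≤ 1 - x - y := by
        intro s hs t ht
        by_contra hst
        push Not at hst
        have hdis : ∀ c ∈ D, ∀ c' ∈ Dᶜ, Disjoint (N c) (N c') := fun c hc c' hc' =>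
          not_linked.1 (hD c hc c' (mem_compl.1 hc'))
        have e1 := density_union_of_disjoint
          (disjoint_union_left.2 ⟨hdis p hp s hs, hdis q hq s hs⟩)
        have e2 := density_union_of_disjoint
          (disjoint_union_left.2 ⟨hdis p hp t ht, hdis q hq t ht⟩)
        have e3 := density_union_of_disjoint
          (disjoint_union_right.2 ⟨hdis p hp s hs, hdis p hp t ht⟩)
        have e4 := density_union_of_disjoint
          (disjoint_union_right.2 ⟨hdis q hq s hs, hdis q hq t ht⟩)
        rw [← union_assoc] at e3 e4
        rcases H.four_elements p q s t with h | h | h | h <;>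
          linarith [H.deg_N p, H.deg_N q, H.deg_N s, H.deg_N t]
      have := H.one_le_add_reachIn hxy hr hry hD.compl hne' (by rwa [compl_compl]) h2
        (by rwa [compl_compl]) hpair' a
      rw [compl_compl] at this
      linarith
  have hcard : (0 : ℝ) < D.card := by exact_mod_cast hne.card_pos
  have hcard' : (0 : ℝ) < Dᶜ.card := by exact_mod_cast hne'.card_pos
  have hγ : (0 : ℝ) < Fintype.card γ := by exact_mod_cast Fintype.card_pos
  have hsplit : ∀ f : γ → ℝ, ∑ c, f c = ∑ c ∈ D, f c + ∑ c ∈ Dᶜ, f c := fun f =>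
    (sum_add_sum_compl D f).symm
  have hw : ∑ c, (if c ∈ D then 1 / (D.card : ℝ) else 1 / (Dᶜ.card : ℝ)) = 2 := by
    rw [hsplit, sum_congr rfl (g := fun _ => 1 / (D.card : ℝ)) fun c hc => if_pos hc,
      sum_congr (s₁ := Dᶜ) rfl (g := fun _ => 1 / (Dᶜ.card : ℝ)) fun c hc =>
        if_neg (mem_compl.1 hc)]
    rw [sum_const, sum_const, nsmul_eq_mul, nsmul_eq_mul, mul_one_div_cancel hcard.ne',
      mul_one_div_cancel hcard'.ne']
    norm_num
  obtain ⟨a, ha⟩ := exists_weight_lt_half (reach P N) H.reach_lt id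
    (fun c => if c ∈ D then 1 / (D.card : ℝ) else 1 / (Dᶜ.card : ℝ))
    (fun c => by split_ifs <;> positivity) (by rw [hw]; norm_num)
  rw [hw, hsplit] at ha
  have e1 : ∑ c ∈ D, (if a ∈ reach P N (id c) then
      (if c ∈ D then 1 / (D.card : ℝ) else 1 / (Dᶜ.card : ℝ)) else 0)
      = density (reachIn P N D a) / density D := by
    rw [← sum_filter, sum_congr rfl (g := fun _ => 1 / (D.card : ℝ)) fun c hc =>
      if_pos (mem_filter.1 hc).1, sum_const, nsmul_eq_mul]
    unfold density reachIn
    simp only [id]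
    field_simp
  have e2 : ∑ c ∈ Dᶜ, (if a ∈ reach P N (id c) then
      (if c ∈ D then 1 / (D.card : ℝ) else 1 / (Dᶜ.card : ℝ)) else 0)
      = density (reachIn P N Dᶜ a) / density Dᶜ := by
    rw [← sum_filter, sum_congr rfl (g := fun _ => 1 / (Dᶜ.card : ℝ)) fun c hc =>
      if_neg (mem_compl.1 (mem_filter.1 hc).1), sum_const, nsmul_eq_mul]
    unfold density reachIn
    simp only [id]
    field_simp
  rw [e1, e2] at ha
  linarith [hall a]

end HalfFree
end Tripartite

/-! ### The range y < 1/4, and the case distinction on y -/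

namespace Tripartite

variable {α β γ : Type*} [Fintype α] [Fintype β] [Fintype γ]
  [DecidableEq α] [DecidableEq β] [DecidableEq γ]

namespace HalfFree

variable {P : α → Finset β} {N : γ → Finset β} {x y : ℝ} [Nonempty α] [Nonempty β] [Nonempty γ]

theorem lt_density_of_unlinked (H : HalfFree P N x y) (h3 : 1 - x < 3 * y) {u v w : γ}
    (huv : ¬ Linked N u v) (huw : ¬ Linked N u w) (hvw : ¬ Linked N v w) :
    1 - x < density (N u ∪ N v ∪ N w) := by
  rw [not_linked] at huv huw hvw
  rw [density_union_of_disjoint (disjoint_union_left.2 ⟨huw, hvw⟩), density_union_of_disjoint huv]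
  linarith [H.deg_N u, H.deg_N v, H.deg_N w]

/-- There are no four pairwise unlinked elements. -/
theorem linked_of_unlinked (H : HalfFree P N x y) (h3 : 1 - x < 3 * y) {p q r s : γ}
    (hpq : ¬ Linked N p q) (hpr : ¬ Linked N p r) (hps : ¬ Linked N p s) (hqr : ¬ Linked N q r)
    (hqs : ¬ Linked N q s) : Linked N r s := by
  by_contra hrs
  rcases H.four_elements p q r s with h | h | h | h
  · exact absurd h (not_le.2 (H.lt_density_of_unlinked h3 hpq hpr hqr))
  · exact absurd h (not_le.2 (H.lt_density_of_unlinked h3 hpq hps hqs))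
  · exact absurd h (not_le.2 (H.lt_density_of_unlinked h3 hpr hps hrs))
  · exact absurd h (not_le.2 (H.lt_density_of_unlinked h3 hqr hqs hrs))

/-- The case in which being linked is not a transitive relation. -/
theorem false_of_not_trans (H : HalfFree P N x y) (hxy : 1 < 2 * x + y) (hx : 3 / 8 ≤ x)
    (hx2 : x < 1 / 2) (hy : y < 1 / 4) (h3 : 1 - x < 3 * y) (hz : (1 - y) * (1 - 2 * y) < x)
    (hc : 2 * (1 - 2 * x) * (1 - y) < y) {r : ℝ} (hr : r ^ 2 ≤ y)
    (hry : (1 - x - 2 * y) * (1 - r) ^ 2 ≤ y * (2 * x + y - 1))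
    {u m v : γ} (hum : Linked N u m) (hmv : Linked N m v) (huv : ¬ Linked N u v) : False := by
  classical
  set T : Finset γ := univ.filter fun t => Linked N u t ∨ Linked N v t ∨ Linked N m t with hT
  have memT : ∀ t, t ∈ T ↔ Linked N u t ∨ Linked N v t ∨ Linked N m t := by simp [hT]
  -- Otherwise every `N t` adds at most 1 - x - d to N u ∪ N v, of density d ≥ 2y. Averaging over t
  -- gives y(1 - d) ≤ 1 - x - d, hence x ≤ (1 - y)(1 - 2y).
  have hex : ∃ z, z ∉ T := by
    by_contra hh
    push Not at hh
    have hd := not_linked.1 huv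
    have e1 := density_union_of_disjoint hd
    have h1 := density_double_count (fun c b => b ∈ N c) univ (N u ∪ N v)ᶜ (p := y)
      (q := 1 - x - density (N u ∪ N v)) (fun b _ => H.deg_right b) (by
        intro t _
        have e2 := H.density_path₃_add_le hx hum hmv ((memT t).1 (hh t)) (H.linked_self t)
        have e3 : Disjoint (N u ∪ N v) ((N u ∪ N v)ᶜ.filter fun b => b ∈ N t) :=
          disjoint_compl_right.mono_right (filter_subset _ _)
        have e4 := density_union_of_disjoint e3
        have e5 : density (N u ∪ N v ∪ (N u ∪ N v)ᶜ.filter fun b => b ∈ N t)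
            ≤ density (N u ∪ N v ∪ N t) :=
          density_mono (union_subset_union_right fun b hb => (mem_filter.1 hb).2)
        linarith)
    rw [density_univ, density_compl] at h1
    nlinarith [H.deg_N u, H.deg_N v]
  obtain ⟨z, hzT⟩ := hex
  have hsep : Separated N T := by
    intro t ht w hw htw
    rw [memT] at ht hw
    push Not at hw
    exact absurd (H.density_path₃_add_le hx hum hmv ht htw)
      (not_le.2 (H.lt_density_of_unlinked h3 huv hw.1 hw.2.1))
  have hgz := H.le_density_of_separated hsep.compl ⟨z, mem_compl.2 hzT⟩
  rw [density_compl] at hgz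
  -- Every t in T is at most two links away from m, each costing at most 1/2 - x.
  have hk : ∀ t ∈ T, density (reach P N t \ reach P N m) ≤ 1 - 2 * x := by
    intro t ht
    have htri : ∀ w, Linked N m w → Linked N w t →
        density (reach P N t \ reach P N m) ≤ 1 - 2 * x := by
      intro w h1 h2
      have e1 := H.density_reach_sdiff_le h1
      have e2 := H.density_reach_sdiff_le h2
      have e3 : reach P N t \ reach P N m ⊆
          (reach P N t \ reach P N w) ∪ (reach P N w \ reach P N m) := by
        intro a ha
        simp only [mem_union, mem_sdiff] at ha ⊢
        tauto
      linarith [density_mono e3, density_union_le (reach P N t \ reach P N w)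
        (reach P N w \ reach P N m)]
    rcases (memT t).1 ht with h | h | h
    · exact htri u hum.symm h
    · exact htri v hmv h
    · exact htri m (H.linked_self m) h
  obtain ⟨a, ha⟩ := H.exists_not_reaching hsep m hk (by nlinarith)
  -- Any two vertices outside T are linked, since u and v are unlinked to both and to each other.
  obtain ⟨a', ha'⟩ := H.exists_not_reaching hsep.compl z (k := 1 / 2 - x) (by
    intro t ht
    rw [mem_compl, memT] at ht
    rw [memT] at hzT
    push Not at ht hzT
    exact H.density_reach_sdiff_le
      (H.linked_of_unlinked h3 huv hzT.1 ht.1 hzT.2.1 ht.2.1)) (by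
    have := density_mono (subset_univ Tᶜ)
    rw [density_univ] at this
    nlinarith [H.pos])
  exact H.false_of_separated hxy hr hry hsep ha ha' (by linarith)

/-- The case in which being linked is a transitive relation. -/
theorem false_of_trans (H : HalfFree P N x y) (hxy : 1 < 2 * x + y) (hx : 3 / 8 ≤ x)
    (hx2 : x < 1 / 2) (h3 : 1 - x < 3 * y) {r : ℝ} (hr : r ^ 2 ≤ y)
    (hry : (1 - x - 2 * y) * (1 - r) ^ 2 ≤ y * (2 * x + y - 1))
    (htrans : ∀ u m v, Linked N u m → Linked N m v → Linked N u v) : False := by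
  classical
  let D : γ → Finset γ := fun v => univ.filter fun t => Linked N v t
  have memD : ∀ v t, t ∈ D v ↔ Linked N v t := by simp [D]
  have hsep : ∀ v, Separated N (D v) := by
    intro v t ht w hw htw
    rw [memD] at ht hw
    exact hw (htrans _ _ _ ht htw)
  have hk : ∀ v, ∀ t ∈ D v, density (reach P N t \ reach P N v) ≤ 1 / 2 - x := fun v t ht =>
    H.density_reach_sdiff_le ((memD v t).1 ht)
  have hmiss : ∀ v, ∃ a, ∀ c ∈ D v, a ∉ reach P N c := by
    intro v
    refine H.exists_not_reaching (hsep v) v (hk v) ?_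
    have := density_mono (subset_univ (D v))
    rw [density_univ] at this
    nlinarith [H.pos]
  -- No a reaches only one link class: it would miss the complement, while some other vertex misses
  -- the class.
  have hfin : ∀ v a, (∀ c, a ∈ reach P N c → Linked N v c) → False := by
    intro v a' h'
    obtain ⟨a, ha⟩ := hmiss v
    refine H.false_of_separated hxy hr hry (hsep v) ha (a' := a') (fun c hc hac => ?_)
      (by linarith)
    exact mem_compl.1 hc ((memD v c).2 (h' c hac))
  have hreach : ∀ v, ∃ a c, a ∈ reach P N c ∧ (∀ c ∈ D v, a ∉ reach P N c) ∧ ¬ Linked N v c := by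
    intro v
    obtain ⟨a, ha⟩ := hmiss v
    obtain ⟨b, hb⟩ := nonempty_of_density_pos ((by linarith : 0 < x).trans_le (H.deg_P a))
    obtain ⟨c, hc⟩ := H.exists_mem_N b
    have hac := mem_reach.2 ⟨b, hb, hc⟩
    exact ⟨a, c, hac, ha, fun hl => ha c ((memD v c).2 hl) hac⟩
  obtain ⟨v₁⟩ := ‹Nonempty γ›
  obtain ⟨a, v₂, -, ha, h12⟩ := hreach v₁
  obtain ⟨v₃, h13, h23⟩ : ∃ v₃, ¬ Linked N v₁ v₃ ∧ ¬ Linked N v₂ v₃ := by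
    by_contra hh
    push Not at hh
    exact hfin v₂ a fun c hac => hh c fun hl => ha c ((memD v₁ c).2 hl) hac
  have hcover : ∀ c, ¬ Linked N v₁ c → ¬ Linked N v₂ c → Linked N v₃ c := fun c h1 h2 =>
    H.linked_of_unlinked h3 h12 h13 h1 h23 h2
  let X : γ → Finset α := fun v => univ.filter fun a => ∃ c ∈ D v, a ∈ reach P N c
  have hX : ∀ v a, a ∉ X v → ∀ c, a ∈ reach P N c → ¬ Linked N v c := by
    intro v a ha c hac hl
    exact ha (mem_filter.2 ⟨mem_univ _, c, (memD v c).2 hl, hac⟩)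
  have hb : ∀ v, y * (density (X v) - 1 / 2) < (1 / 2 - x) * density (D v) := fun v =>
    H.density_reaching_lt (hsep v) v (hk v)
  have hdis : ∀ v w, ¬ Linked N v w → Disjoint (D v) (D w) := by
    intro v w hvw
    rw [disjoint_left]
    intro t ht ht'
    exact hvw (htrans _ _ _ ((memD v t).1 ht) ((memD w t).1 ht').symm)
  have hsum := density_add_le_one
    (disjoint_union_left.2 ⟨hdis v₁ v₃ h13, hdis v₂ v₃ h23⟩)
  rw [density_union_of_disjoint (hdis v₁ v₂ h12)] at hsum
  -- The sum is below 3/2 + (1/2 - x) / y, and 1 - 2x < y. Hence some a lies in at most one of the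
  -- three sets.
  have hlt : density (X v₁) + density (X v₂) + density (X v₃) < 2 := by
    have h1 := hb v₁
    have h2 := hb v₂
    have h3' := hb v₃
    by_contra hge
    push Not at hge
    nlinarith [H.pos, mul_le_mul_of_nonneg_left hsum (by linarith : 0 ≤ 1 / 2 - x),
      mul_le_mul_of_nonneg_left hge H.pos.le]
  have hui := density_union_add_inter (X v₁) (X v₂)
  rcases lt_or_ge (density (X v₁ ∪ X v₂)) 1 with h | h
  · obtain ⟨a, ha⟩ := exists_notMem_of_density_lt_one h
    rw [mem_union, not_or] at ha
    exact hfin v₃ a fun c hac => hcover c (hX _ _ ha.1 c hac) (hX _ _ ha.2 c hac)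
  · obtain ⟨a, ha⟩ := exists_notMem_of_density_lt_one (s := X v₁ ∩ X v₂ ∪ X v₃)
      (by linarith [density_union_le (X v₁ ∩ X v₂) (X v₃)])
    rw [mem_union, mem_inter, not_or, not_and_or] at ha
    rcases ha with ⟨h1 | h1, h2⟩
    · refine hfin v₂ a fun c hac => ?_
      by_contra hl
      exact hX _ _ h2 c hac (hcover c (hX _ _ h1 c hac) hl)
    · refine hfin v₁ a fun c hac => ?_
      by_contra hl
      exact hX _ _ h2 c hac (hcover c hl (hX _ _ h1 c hac))

theorem lt_half (H : HalfFree P N x y) : x < 1 / 2 := by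
  obtain ⟨c⟩ := ‹Nonempty γ›
  obtain ⟨b, hb⟩ := H.nonempty_N c
  refine (H.deg_left b).trans_lt ((density_mono fun a ha => ?_).trans_lt (H.reach_lt c))
  exact mem_reach.2 ⟨b, (mem_filter.1 ha).2, hb⟩

theorem not_poly_neg (H : HalfFree P N x y) (hx : 0 < x) (hy : y ≤ 1) :
    ¬ x ^ 2 * (1 + 3 * y) + x * (4 * y ^ 2 - y - 2) + 1 - 2 * y + 2 * y ^ 3 < 0 := by
  intro h
  have hx2 := H.lt_half
  rcases le_or_gt (1 / 3) y with hy3 | hy3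
  · have h1 := quarter_lt_of_poly_neg hy3 hy hx h
    have h2 := one_lt_add_two_mul_of_poly_neg H.pos hy3 h
    exact H.false_of_pow_lt h1.le h2 (pow_lt_of_one_lt h1 h2 H.pos hy)
  have hxy := one_lt_two_mul_add_of_poly_neg H.pos hy3 h
  rcases le_or_gt (1 / 4) y with hy4 | hy4
  · exact H.false_of_quarter_le hx hy4 hxy
  obtain ⟨h3, hz, hc, hry, hr⟩ := bounds_of_linear_lt hy4 hx2
    (linear_lt_of_poly_neg H.pos hy4 hx2 h)
  by_cases htrans : ∀ u m v, Linked N u m → Linked N m v → Linked N u v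
  · exact H.false_of_trans hxy (by linarith) hx2 h3 hr hry.le htrans
  · push Not at htrans
    obtain ⟨u, m, v, hum, hmv, huv⟩ := htrans
    exact H.false_of_not_trans hxy (by linarith) hx2 hy4 h3 hz hc hr hry.le hum hmv huv

end HalfFree

/-! ### From graphs to the density setting -/

theorem card_filter_coe {V : Type*} [Finite V] (B : Set V) [Fintype B] (p : V → Prop)
    [DecidablePred p] :
    (univ.filter fun b : B => p b).card = ({v | p v} ∩ B).ncard := by
  classical
  rw [← Set.ncard_coe_finset, ← Set.ncard_image_of_injective _ Subtype.val_injective]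
  congr 1
  ext v
  simp [and_comm]

theorem IsBiconstrained.exists_half_le {V : Type*} [Finite V] {G : SimpleGraph V} {x y : ℝ}
    {A B C : Set V} (hG : IsBiconstrained G x y A B C) (hx : 0 < x) (hy : 0 < y) (hy1 : y ≤ 1)
    (h : x ^ 2 * (1 + 3 * y) + x * (4 * y ^ 2 - y - 2) + 1 - 2 * y + 2 * y ^ 3 < 0) :
    ∃ v ∈ C, 1 / 2 * (A.ncard : ℝ) ≤ ((secondNeighborSet G v ∩ A).ncard : ℝ) := by
  classical
  by_contra hcon
  push Not at hcon
  let _ : Fintype A := Fintype.ofFinite _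
  let _ : Fintype B := Fintype.ofFinite _
  let _ : Fintype C := Fintype.ofFinite _
  have : Nonempty A := hG.nonempty_A.to_subtype
  have : Nonempty B := hG.nonempty_B.to_subtype
  have : Nonempty C := hG.nonempty_C.to_subtype
  have hden : ∀ (S : Set V) [Fintype S] [Nonempty S] (p : V → Prop) [DecidablePred p] (t : ℝ),
      t * (S.ncard : ℝ) ≤ (({v | p v} ∩ S).ncard : ℝ) →
        t ≤ density (univ.filter fun b : S => p b) := by
    intro S _ _ p _ t hle
    unfold density
    rw [card_filter_coe, le_div_iff₀ (by exact_mod_cast Fintype.card_pos), Fintype.card_eq_nat_card,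
      Nat.card_coe_set_eq]
    exact hle
  let P : A → Finset B := fun a => univ.filter fun b => G.Adj a b
  let N : C → Finset B := fun c => univ.filter fun b => G.Adj c b
  have H : HalfFree P N x y := by
    refine ⟨hy, fun a => ?_, fun c => ?_, fun b => ?_, fun b => ?_, fun c => ?_⟩
    · exact hden B (fun b => G.Adj a b) x (hG.deg_AB a a.2)
    · exact hden B (fun b => G.Adj c b) y (hG.deg_CB c c.2)
    · have := hden A (fun a => G.Adj b a) x (hG.deg_BA b b.2)
      simpa [P, G.adj_comm] using this
    · have := hden C (fun a => G.Adj b a) y (hG.deg_BC b b.2)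
      simpa [N, G.adj_comm] using this
    · have hc := hcon c c.2
      have hA : (0 : ℝ) < Fintype.card A := by exact_mod_cast Fintype.card_pos
      -- A common neighbour gives distance at most two; disjointness of A and C and the absence of
      -- edges between them exclude 0 and 1.
      have hsub : ((reach P N c).card : ℝ) ≤ ((secondNeighborSet G c ∩ A).ncard : ℝ) := by
        have h1 := card_filter_coe A (fun v => v ∈ secondNeighborSet G c)
        rw [Set.ofPred_mem_eq] at h1
        rw [← h1]
        refine Nat.cast_le.2 (card_le_card fun a ha => ?_)
        obtain ⟨b, hab, hcb⟩ := mem_reach.1 ha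
        have hab : G.Adj a b := (mem_filter.1 hab).2
        have hcb : G.Adj c b := (mem_filter.1 hcb).2
        refine mem_filter.2 ⟨mem_univ _, ?_⟩
        have hne : (c : V) ≠ a := fun he => Set.disjoint_left.1 hG.disjoint_AC a.2 (he ▸ c.2)
        have hnadj : ¬ G.Adj c a := fun hadj => hG.no_edge_AC a a.2 c c.2 hadj.symm
        let w : G.Walk (c : V) a := .cons hcb (.cons hab.symm .nil)
        have h2 : G.dist c a ≤ 2 := SimpleGraph.dist_le w
        have h0 : G.dist (c : V) a ≠ 0 := fun h0 => hne ((w.reachable.dist_eq_zero_iff).1 h0)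
        have h1 : G.dist (c : V) a ≠ 1 := fun h1 => hnadj (SimpleGraph.dist_eq_one_iff_adj.1 h1)
        show G.dist c a = 2
        omega
      unfold density
      rw [div_lt_iff₀ hA, Fintype.card_eq_nat_card, Nat.card_coe_set_eq]
      linarith
  exact H.not_poly_neg hx hy1 h

end Tripartite

theorem mainTheorem7 (x y : ℝ) (hx : x ∈ Set.Ioc (0 : ℝ) 1) (hy : y ∈ Set.Ioc (0 : ℝ) 1)
    (h : x ^ 2 * (1 + 3 * y) + x * (4 * y ^ 2 - y - 2) + 1 - 2 * y + 2 * y ^ 3 < 0) :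
    1 / 2 ≤ Tripartite.psi x y := by
  refine le_csSup ⟨1, fun z hz => hz.1.2⟩ ⟨⟨by norm_num, by norm_num⟩, ?_⟩
  intro V _ G A B C hG
  exact hG.exists_half_le hx.1 hy.1 hy.2 h
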